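/- Conventions. Strings are finite binary strings, $|y|$ is the length of $y$, and objects (strings, natural numbers, finite lists, pairs of programs) are identified with natural numbers by a standard computable coding. Let $U$ be an optimal machine for plain conditional Kolmogorov complexity: a partial computable function of a binary program and a condition such that for every partial computable $V$ there is a constant $e$ with the property that whenever $V(p,z)=a$ there is a program $q$ with $|q|\le|p|+e$ and $U(q,z)=a$. Put $C(a\mid z)=\min\{|p| : U(p,z)=a\}$, and let $C(a)$ be $C(a\mid z)$ for a trivial condition $z$. For an integer-valued function $h$ on $\{0,1,\dots,k\}$, $C(h)$ is the complexity of the list $h(0),\dots,h(k)$. A one-way protocol is a pair of programs $P=(P_A,P_B)$: on input $y$ Bob's program $P_B$ computes a binary string $m$, which is sent to Alice as a whole (the messages need not form a prefix-free set), and on input $x$ and $m$ Alice's program $P_A$ computes her output. For a string $y$ of length $n$ and a natural number $\alpha$, $TCC_I^{\alpha}(y)$ is the minimum of the length of the message sent on $y$, over all one-way protocols $P$ with $C(P\mid n)\le\alpha$ that on every pair $(x',y')$ of strings of length $n$ terminate with Alice outputting $y'$ (it is $\infty$ if there is no such protocol). Let $\ell(n)=\lfloor\log_2 n\rfloor+1$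 for $n\ge1$ and $\ell(0)=1$. Theorem. For every optimal $U$ and every constant $c$ there is a constant $d$ such that the following holds for all natural numbers $k\le n$. Let $h:\{0,1,\dots,k\}\to\mathbb{N}$ be a strictly decreasing function with $h(0)=n$, $h(k)=0$, $C(h)\le c\,\ell(n)$ and $h(\alpha)+\alpha\ge k$ for all $\alpha\in\{0,\dots,k\}$. Then there is a string $y$ of length $n$ with $|C(y)-k|\le d\,\ell(n)$ such that \begin{align*} TCC_I^{\alpha+d\,\ell(n)}(y)&\le h(\alpha) &&\text{for all integers } 0\le\alpha\le k,\\ h(\alpha+d\,\ell(n))&\le TCC_I^{\alpha}(y) &&\text{for all integers } \alpha\ge0 \text{ with } \alpha+d\,\ell(n)\le k. \end{align*} -/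

import Mathlib

/-- Finite binary strings. -/
abbrev BitString := List Bool

/-- A description mode: it takes a binary program and the code of a condition, and it returns the
code of an object (or diverges). Objects and conditions are coded by natural numbers through the
computable coding `Encodable.encode`. -/
abbrev DescriptionMode := BitString → ℕ →. ℕ

/-- An optimal (reference universal) machine for plain conditional Kolmogorov complexity: it is
partial computable, and it simulates every other partial computable description mode at the price
of a constant number of additional program bits. -/
structure IsOptimalMachine (U : DescriptionMode) : Prop where
  partrec : Partrec₂ U
  optimal : ∀ V : DescriptionMode, Partrec₂ V →
    ∃ c : ℕ, ∀ (p : BitString) (z a : ℕ), a ∈ V p z →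
      ∃ q : BitString, q.length ≤ p.length + c ∧ a ∈ U q z

/-- Plain conditional Kolmogorov complexity `C(a | b)`: the least length of a program from which
`U`, given `b`, computes `a`. -/
noncomputable def condC (U : DescriptionMode) {A B : Type} [Primcodable A] [Primcodable B]
    (a : A) (b : B) : ℕ∞ :=
  ⨅ (p : BitString) (_ : Encodable.encode a ∈ U p (Encodable.encode b)), (p.length : ℕ∞)

/-- Plain Kolmogorov complexity `C(a)`, the condition being trivial. -/
noncomputable def plainC (U : DescriptionMode) {A : Type} [Primcodable A] (a : A) : ℕ∞ :=
  condC U a ()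

/-- A one-way protocol `(P_A, P_B)`: Bob's program turns his input into the message that he sends,
Alice's program turns her input and the whole message into her output. -/
structure OneWayProtocol where
  alice : Nat.Partrec.Code
  bob : Nat.Partrec.Code

namespace OneWayProtocol

/-- On input `y` Bob's program halts and sends the message `m`. -/
def Sends (P : OneWayProtocol) (y m : BitString) : Prop :=
  Encodable.encode m ∈ P.bob.eval (Encodable.encode y)

/-- On input `x` and message `m` Alice's program halts with output `z`. -/
def Outputs (P : OneWayProtocol) (x m z : BitString) : Prop :=
  Encodable.encode z ∈ P.alice.eval (Encodable.encode (x, m))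

/-- `P` is total on the strings of length `n` and computes `f` correctly on all of them. -/
def TotallyComputes (P : OneWayProtocol) (n : ℕ) (f : BitString → BitString → BitString) : Prop :=
  ∀ x y : BitString, x.length = n → y.length = n →
    ∃ m : BitString, P.Sends y m ∧ P.Outputs x m (f x y)

/-- The complexity `C(P | n)` of a protocol for strings of length `n`. -/
noncomputable def complexity (U : DescriptionMode) (P : OneWayProtocol) (n : ℕ) : ℕ∞ :=
  condC U (P.alice, P.bob) n

end OneWayProtocol

/-- One-way total communication complexity `TCC_f^α(y)`: the least number of bits that Bob sends on
input `y`, over all one-way protocols of complexity at most `α` that are total on the strings of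
length `|y|` and always compute `f` correctly; it is `⊤` if there is no such protocol. -/
noncomputable def TCC (U : DescriptionMode) (f : BitString → BitString → BitString)
    (α : ℕ) (y : BitString) : ℕ∞ :=
  ⨅ (P : OneWayProtocol) (m : BitString) (_ : P.TotallyComputes y.length f)
    (_ : P.complexity U y.length ≤ (α : ℕ∞)) (_ : P.Sends y m), (m.length : ℕ∞)

/-- The identity function `I(x, y) = y`. -/
def identityFn : BitString → BitString → BitString := fun _ y => y

/-- The finite object that a function on the integer interval `[0, k]` is: the list of its
values `h(0), …, h(k)`. -/
def valueTable (h : ℕ → ℕ) (k : ℕ) : List ℕ := (List.range (k + 1)).map h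

/-- The length of the binary notation of `n`, the unit of logarithmic precision;
it is `1` for `n = 0`. -/
def logLen (n : ℕ) : ℕ := Nat.log 2 n + 1

/-!
Protocols are enumerated through their descriptions, and every string of length `n = h 0` is
removed on which a protocol found to be total and described by `j` bits sends fewer than `h j` bits
(up to a logarithmic shift in `j`). A protocol that never errs sends different messages on
different inputs, so it removes fewer than `2 ^ h j` strings. As `h j + j` is nonincreasing, these
numbers add up, over all the descriptions, to less than `2 ^ n`. Let `y` be the first string that is
never removed: the lower bounds on message lengths hold for `y` by construction, and the one on
`C y` follows, since a short description of `y` would give a short protocol with an empty message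
on `y`.

For the upper bounds, give `i` bits of advice: how many whole multiples of `2 ^ h i` are contained
in the sum of the numbers `2 ^ min (h j) (h i)` over all descriptions of total protocols. From the
moment when this count is reached, fewer than `2 ^ h i` further strings are removed, so `y` is among
the first `2 ^ h i` strings that have survived by then. These strings can be sent as messages of
length `h i`, and all other strings verbatim. For `i = k` only one candidate remains, which bounds
`C y`.
-/

open Encodable
open Nat.Partrec (Code)

section Primrec

attribute [fun_prop] Primrec Primrec.id Primrec.const Primrec.comp Primrec.pair Primrec.fst
  Primrec.snd Primrec.encode Primrec.decode₂ Primrec.list_length Primrec.list_range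
  Primrec.list_headI Primrec.option_isSome

variable {α β σ : Type*} [Primcodable α] [Primcodable β] [Primcodable σ]

@[fun_prop]
theorem primrec_cond {c : σ → Bool} {f g : σ → α} (hc : Primrec c) (hf : Primrec f)
    (hg : Primrec g) : Primrec fun a => bif c a then f a else g a :=
  Primrec.cond hc hf hg

@[fun_prop]
theorem primrec_some {f : σ → α} (hf : Primrec f) : Primrec fun a => some (f a) :=
  Primrec.option_some.comp hf

@[fun_prop]
theorem primrec_option_bind {f : σ → Option α} {g : σ → α → Option β} (hf : Primrec f)
    (hg : Primrec fun x : σ × α => g x.1 x.2) : Primrec fun a => (f a).bind (g a) :=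
  Primrec.option_bind hf hg

@[fun_prop]
theorem primrec_option_getD {f : σ → Option α} {g : σ → α} (hf : Primrec f) (hg : Primrec g) :
    Primrec fun a => (f a).getD (g a) :=
  Primrec.option_getD.comp hf hg

@[fun_prop]
theorem primrec_option_all {f : σ → Option α} {p : σ → α → Bool} (hf : Primrec f)
    (hp : Primrec fun x : σ × α => p x.1 x.2) : Primrec fun a => (f a).all (p a) :=
  (Primrec.option_casesOn hf (Primrec.const true) hp).of_eq fun a => by cases f a <;> rfl

@[fun_prop]
theorem primrec_nat_add {f g : σ → ℕ} (hf : Primrec f) (hg : Primrec g) :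
    Primrec fun a => f a + g a :=
  Primrec.nat_add.comp hf hg

@[fun_prop]
theorem primrec_nat_sub {f g : σ → ℕ} (hf : Primrec f) (hg : Primrec g) :
    Primrec fun a => f a - g a :=
  Primrec.nat_sub.comp hf hg

@[fun_prop]
theorem primrec_nat_div {f g : σ → ℕ} (hf : Primrec f) (hg : Primrec g) :
    Primrec fun a => f a / g a :=
  Primrec.nat_div.comp hf hg

@[fun_prop]
theorem primrec_nat_min {f g : σ → ℕ} (hf : Primrec f) (hg : Primrec g) :
    Primrec fun a => min (f a) (g a) :=
  Primrec.nat_min.comp hf hg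

@[fun_prop]
theorem primrec_nat_pow {f g : σ → ℕ} (hf : Primrec f) (hg : Primrec g) :
    Primrec fun a => f a ^ g a :=
  (Primrec₂.unpaired'.1 Nat.Primrec.pow).comp hf hg

@[fun_prop]
theorem primrec_nat_beq {f g : σ → ℕ} (hf : Primrec f) (hg : Primrec g) :
    Primrec fun a => f a == g a :=
  Primrec.beq.comp hf hg

@[fun_prop]
theorem primrec_decide_nat_le {f g : σ → ℕ} (hf : Primrec f) (hg : Primrec g) :
    Primrec fun a => decide (f a ≤ g a) :=
  (PrimrecRel.comp Primrec.nat_le hf hg).decide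

@[fun_prop]
theorem primrec_list_cons {f : σ → α} {g : σ → List α} (hf : Primrec f) (hg : Primrec g) :
    Primrec fun a => f a :: g a :=
  Primrec.list_cons.comp hf hg

@[fun_prop]
theorem primrec_list_take {f : σ → ℕ} {g : σ → List α} (hf : Primrec f) (hg : Primrec g) :
    Primrec fun a => (g a).take (f a) :=
  Primrec.list_take.comp hf hg

@[fun_prop]
theorem primrec_list_drop {f : σ → ℕ} {g : σ → List α} (hf : Primrec f) (hg : Primrec g) :
    Primrec fun a => (g a).drop (f a) :=
  Primrec.list_drop.comp hf hg

@[fun_prop]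
theorem primrec_list_getElem? {f : σ → List α} {g : σ → ℕ} (hf : Primrec f) (hg : Primrec g) :
    Primrec fun a => (f a)[g a]? :=
  Primrec.list_getElem?.comp hf hg

@[fun_prop]
theorem primrec_list_getD {f : σ → List α} {g : σ → ℕ} {d : σ → α} (hf : Primrec f)
    (hg : Primrec g) (hd : Primrec d) : Primrec fun a => (f a).getD (g a) (d a) := by
  simp only [List.getD_eq_getElem?_getD]
  fun_prop

@[fun_prop]
theorem primrec_list_idxOf [BEq α] [LawfulBEq α] {f : σ → List α} {g : σ → α} (hf : Primrec f)
    (hg : Primrec g) : Primrec fun a => (f a).idxOf (g a) := by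
  classical
  convert Primrec.list_idxOf.comp hg hf

@[fun_prop]
theorem primrec_list_map {f : σ → List α} {g : σ → α → β} (hf : Primrec f)
    (hg : Primrec fun x : σ × α => g x.1 x.2) : Primrec fun a => (f a).map (g a) :=
  Primrec.list_map hf hg

@[fun_prop]
theorem primrec_list_flatMap {f : σ → List α} {g : σ → α → List β} (hf : Primrec f)
    (hg : Primrec fun x : σ × α => g x.1 x.2) : Primrec fun a => (f a).flatMap (g a) :=
  Primrec.list_flatMap hf hg

@[fun_prop]
theorem primrec_list_filter {f : σ → List α} {p : σ → α → Bool} (hf : Primrec f)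
    (hp : Primrec fun x : σ × α => p x.1 x.2) : Primrec fun a => (f a).filter (p a) :=
  (Primrec.listFilterMap (g := fun a y => bif p a y then some y else none) hf
    (Primrec.cond hp (by fun_prop) (by fun_prop))).of_eq fun a => by
      rw [← List.filterMap_eq_filter]
      congr 1
      ext1 y
      cases h : p a y <;> simp [h, Option.guard]

@[fun_prop]
theorem primrec_list_all {f : σ → List α} {p : σ → α → Bool} (hf : Primrec f)
    (hp : Primrec fun x : σ × α => p x.1 x.2) : Primrec fun a => (f a).all (p a) := by
  have hfold : Primrec fun a => (f a).foldr (fun y b => bif p a y then b else false) true :=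
    Primrec.list_foldr (h := fun a x => bif p a x.1 then x.2 else false) hf (by fun_prop)
      (Primrec.cond (hp.comp (Primrec.fst.pair (Primrec.fst.comp Primrec.snd)))
        (Primrec.snd.comp Primrec.snd) (Primrec.const false))
  exact hfold.of_eq fun a => by
    induction f a with
    | nil => rfl
    | cons y l ih => cases h : p a y <;> simp_all

@[fun_prop]
theorem primrec_list_sum {f : σ → List ℕ} (hf : Primrec f) : Primrec fun a => (f a).sum :=
  Primrec.list_foldr (h := fun _ x => x.1 + x.2) hf (Primrec.const 0) (by unfold Primrec₂; fun_prop)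

@[fun_prop]
theorem primrec_list_replicate {f : σ → ℕ} {g : σ → α} (hf : Primrec f) (hg : Primrec g) :
    Primrec fun a => List.replicate (f a) (g a) := by
  have : Primrec fun a => (List.range (f a)).map fun _ => g a := by fun_prop
  simpa only [List.map_const', List.length_range] using this

@[fun_prop]
theorem primrec_evaln {t z : σ → ℕ} {c : σ → Code} (ht : Primrec t) (hc : Primrec c)
    (hz : Primrec z) : Primrec fun a => (c a).evaln (t a) (z a) :=
  Code.primrec_evaln.comp ((ht.pair hc).pair hz)

@[fun_prop]
theorem primrec_curry {c : σ → Code} {z : σ → ℕ} (hc : Primrec c) (hz : Primrec z) :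
    Primrec fun a => (c a).curry (z a) :=
  Code.primrec₂_curry.comp hc hz

@[fun_prop]
theorem primrec_logLen {f : σ → ℕ} (hf : Primrec f) : Primrec fun a => logLen (f a) := by
  have hlog (n : ℕ) : n.findGreatest (2 ^ · ≤ n) = Nat.log 2 n := by
    rcases Nat.eq_zero_or_pos n with rfl | hn
    · simp
    · refine Nat.findGreatest_eq_iff.2 ⟨Nat.log_le_self 2 n,
        fun _ => Nat.pow_log_le_self 2 hn.ne', fun j hj _ => ?_⟩
      exact not_le.2 (Nat.lt_pow_of_log_lt one_lt_two hj)
  have hrel : PrimrecRel fun n j : ℕ => 2 ^ j ≤ n :=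
    PrimrecRel.comp Primrec.nat_le (by fun_prop) (by fun_prop)
  exact Primrec.succ.comp <| (Primrec.nat_findGreatest Primrec.id hrel).comp hf |>.of_eq
    fun a => hlog (f a)

end Primrec

section BitString

/-- The list of all binary strings of length `n`. -/
def bitStrings : ℕ → List BitString
  | 0 => [[]]
  | n + 1 => (bitStrings n).flatMap fun s => [false :: s, true :: s]

theorem mem_bitStrings {n : ℕ} {s : BitString} : s ∈ bitStrings n ↔ s.length = n := by
  induction n generalizing s with
  | zero => simp [bitStrings]
  | succ n ih =>
    cases s with
    | nil => simp [bitStrings]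
    | cons b s => cases b <;> simp [bitStrings, ih]

theorem length_bitStrings (n : ℕ) : (bitStrings n).length = 2 ^ n := by
  induction n with
  | zero => simp [bitStrings]
  | succ n ih => simp [bitStrings, List.length_flatMap, ih, pow_succ]

theorem nodup_bitStrings (n : ℕ) : (bitStrings n).Nodup := by
  induction n with
  | zero => simp [bitStrings]
  | succ n ih =>
    refine List.nodup_flatMap.2 ⟨by simp, ih.imp fun hne => ?_⟩
    simp [Function.onFun, hne.symm]

@[fun_prop]
theorem primrec_bitStrings : Primrec bitStrings := by
  have hstep : Primrec₂ fun (_ : ℕ) (l : List BitString) =>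
      l.flatMap fun s => [false :: s, true :: s] := by
    unfold Primrec₂
    fun_prop
  refine (Primrec.nat_rec₁ [[]] hstep).of_eq fun n => ?_
  induction n with
  | zero => rfl
  | succ n ih => simp only [bitStrings, ← ih]

/-- The list of all binary strings of length less than `n`. -/
def bitStringsBelow (n : ℕ) : List BitString := (List.range n).flatMap bitStrings

theorem mem_bitStringsBelow {n : ℕ} {s : BitString} : s ∈ bitStringsBelow n ↔ s.length < n := by
  simp [bitStringsBelow, mem_bitStrings]

@[fun_prop]
theorem primrec_bitStringsBelow : Primrec bitStringsBelow := by
  unfold bitStringsBelow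
  fun_prop

theorem nodup_bitStringsBelow (n : ℕ) : (bitStringsBelow n).Nodup := by
  refine List.nodup_flatMap.2 ⟨fun j _ => nodup_bitStrings j, List.nodup_range.imp fun hne => ?_⟩
  intro s hs hs'
  exact hne ((mem_bitStrings.1 hs).symm.trans (mem_bitStrings.1 hs'))

theorem sum_map_length_bitStringsBelow (n : ℕ) (g : ℕ → ℕ) :
    ((bitStringsBelow n).map fun s => g s.length).sum = ∑ j ∈ Finset.range n, 2 ^ j * g j := by
  have hconst (j : ℕ) :
      (bitStrings j).map (fun s => g s.length) = List.replicate (2 ^ j) (g j) := by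
    rw [← length_bitStrings, ← List.map_const']
    exact List.map_congr_left fun s hs => by rw [mem_bitStrings.1 hs]
  induction n with
  | zero => simp [bitStringsBelow]
  | succ n ih =>
    rw [bitStringsBelow, List.range_succ, List.flatMap_append, ← bitStringsBelow, List.map_append,
      List.sum_append, ih, List.flatMap_singleton, hconst, List.sum_replicate, smul_eq_mul,
      Finset.sum_range_succ]

theorem length_bitStringsBelow_lt (n : ℕ) : (bitStringsBelow n).length < 2 ^ n := by
  calc (bitStringsBelow n).length = ∑ j ∈ Finset.range n, 2 ^ j := by
        simpa using sum_map_length_bitStringsBelow n fun _ => 1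
    _ < 2 ^ n := Nat.geomSum_lt le_rfl (by simp)

/-- The number denoted by a binary string: its index among the strings of the same length. -/
def rank (s : BitString) : ℕ := (bitStrings s.length).idxOf s

@[fun_prop]
theorem primrec_rank : Primrec rank := by
  unfold rank
  fun_prop

theorem exists_length_eq_rank_eq {j q : ℕ} (hq : q < 2 ^ j) :
    ∃ s : BitString, s.length = j ∧ rank s = q := by
  rw [← length_bitStrings] at hq
  have hlen : (bitStrings j)[q].length = j := mem_bitStrings.1 (List.getElem_mem hq)
  exact ⟨(bitStrings j)[q], hlen, by rw [rank, hlen, (nodup_bitStrings j).idxOf_getElem q hq]⟩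

/-- The self-delimiting form of a string: its length in unary, closed by a zero, and then the string
itself. -/
def selfDelimit (s : BitString) : BitString := List.replicate s.length true ++ false :: s

/-- Splits a string after a leading self-delimited string, which it decodes. -/
def splitSelfDelimited (p : BitString) : BitString × BitString :=
  ((p.drop (p.idxOf false + 1)).take (p.idxOf false),
    (p.drop (p.idxOf false + 1)).drop (p.idxOf false))

theorem primrec_splitSelfDelimited : Primrec splitSelfDelimited := by
  unfold splitSelfDelimited
  fun_prop

theorem length_selfDelimit (s : BitString) : (selfDelimit s).length = 2 * s.length + 1 := by
  simp only [selfDelimit, List.length_append, List.length_replicate, List.length_cons]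
  omega

theorem splitSelfDelimited_selfDelimit_append (s r : BitString) :
    splitSelfDelimited (selfDelimit s ++ r) = (s, r) := by
  have hidx : (selfDelimit s ++ r).idxOf false = s.length := by
    rw [selfDelimit, List.append_assoc, List.idxOf_append_of_notMem (by simp)]
    simp
  have hdrop : (selfDelimit s ++ r).drop (s.length + 1) = s ++ r := by
    simp [selfDelimit, List.drop_append]
  simp [splitSelfDelimited, hidx, hdrop]

end BitString

section Sieve

theorem mem_take_filter_of_find?_eq_some {α : Type*} {l : List α} {P Q : α → Bool} {y : α}
    {n : ℕ} (hy : l.find? Q = some y) (hP : P y) (hn : l.countP (fun z => P z && !Q z) < n) :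
    y ∈ (l.filter P).take n := by
  obtain ⟨-, before, after, rfl, hbefore⟩ := List.find?_eq_some_iff_append.1 hy
  have hcount : before.countP P ≤ (before ++ y :: after).countP fun z => P z && !Q z := by
    rw [List.countP_append]
    refine le_add_right (List.countP_congr fun z hz => ?_).le
    simp [hbefore z hz]
  rw [List.filter_append, List.filter_cons_of_pos hP, List.take_append,
    ← List.countP_eq_length_filter]
  exact List.mem_append_right _ (List.mem_take_iff_getElem.2 ⟨0, by simp; omega, rfl⟩)

theorem exists_forall_mem_finset_of_monotone {ι : Type*} {P : ℕ → ι → Prop} (hP : Monotone P)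
    (s : Finset ι) : ∃ T, ∀ p ∈ s, ∀ t, P t p → P T p := by
  have hev : ∀ᶠ T in Filter.atTop, ∀ p ∈ s, ∀ t, P t p → P T p := by
    refine (Filter.eventually_all_finset s).2 fun p _ => ?_
    by_cases hp : ∃ t, P t p
    · obtain ⟨t, ht⟩ := hp
      filter_upwards [Filter.eventually_ge_atTop t] with T hT _ _ using hP hT p ht
    · exact Filter.Eventually.of_forall fun T t ht => absurd ⟨t, ht⟩ hp
  exact hev.exists

theorem sum_sdiff_two_pow_lt {ι : Type*} [DecidableEq ι] {A B : Finset ι} {w : ι → ℕ} {m : ℕ}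
    (hAB : A ⊆ B)
    (h : (∑ p ∈ A, 2 ^ min (w p) m) / 2 ^ m = (∑ p ∈ B, 2 ^ min (w p) m) / 2 ^ m) :
    ∑ p ∈ B \ A, 2 ^ w p < 2 ^ m := by
  have hmin : ∑ p ∈ B \ A, 2 ^ min (w p) m < 2 ^ m := by
    have hsum := Finset.sum_sdiff (f := fun p => 2 ^ min (w p) m) hAB
    have hA := Nat.div_add_mod (∑ p ∈ A, 2 ^ min (w p) m) (2 ^ m)
    have hB := Nat.div_add_mod (∑ p ∈ B, 2 ^ min (w p) m) (2 ^ m)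
    have hmod := Nat.mod_lt (∑ p ∈ B, 2 ^ min (w p) m) (Nat.two_pow_pos m)
    rw [h] at hA
    omega
  refine (Finset.sum_congr rfl fun p hp => ?_).trans_lt hmin
  have hp : 2 ^ min (w p) m < 2 ^ m :=
    (Finset.single_le_sum (fun _ _ => Nat.zero_le _) hp).trans_lt hmin
  have := (Nat.pow_lt_pow_iff_right one_lt_two).1 hp
  rw [min_eq_left (by omega)]

theorem card_filter_exists_short_le {ι α : Type*} (s : Finset α) (X : Finset ι) (w : ι → ℕ)
    {f : ι → α → Option BitString}
    (hf : ∀ p y y' m, f p y = some m → f p y' = some m → y = y')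
    [DecidablePred fun y => ∃ p ∈ X, ∃ m, f p y = some m ∧ m.length < w p] :
    (s.filter fun y => ∃ p ∈ X, ∃ m, f p y = some m ∧ m.length < w p).card ≤ ∑ p ∈ X, 2 ^ w p := by
  classical
  have hsub : (s.filter fun y => ∃ p ∈ X, ∃ m, f p y = some m ∧ m.length < w p) ⊆
      X.biUnion fun p => s.filter fun y => ∃ m, f p y = some m ∧ m.length < w p := by
    intro y
    simp only [Finset.mem_filter, Finset.mem_biUnion]
    rintro ⟨hy, p, hp, hshort⟩
    exact ⟨p, hp, hy, hshort⟩
  refine (Finset.card_le_card hsub).trans (Finset.card_biUnion_le.trans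
    (Finset.sum_le_sum fun p _ => ?_))
  have hmaps : ∀ y ∈ s.filter (fun y => ∃ m, f p y = some m ∧ m.length < w p),
      (f p y).getD [] ∈ (bitStringsBelow (w p)).toFinset := by
    intro y hy
    obtain ⟨-, m, hm, hshort⟩ := Finset.mem_filter.1 hy
    rw [hm, List.mem_toFinset]
    exact mem_bitStringsBelow.2 hshort
  refine (Finset.card_le_card_of_injOn _ hmaps fun y hy y' hy' heq => ?_).trans
    ((List.toFinset_card_le _).trans (length_bitStringsBelow_lt _).le)
  obtain ⟨-, m, hm, -⟩ := Finset.mem_filter.1 hy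
  obtain ⟨-, m', hm', -⟩ := Finset.mem_filter.1 hy'
  simp only [hm, hm', Option.getD_some] at heq
  exact hf p y y' m hm (heq ▸ hm')

/-- Finitely many programs that gradually assign code words to finitely many target objects:
`encoding t p y` is the code word of `y` that `p` is seen to produce within `t` steps. A program is
supposed to produce no code word shorter than its threshold; the sieve removes the targets on which
an active program violates this. -/
structure EncodingSieve (ι α : Type*) where
  targets : List α
  nodup_targets : targets.Nodup
  programs : List ι
  nodup_programs : programs.Nodup
  threshold : ι → ℕ
  encoding : ℕ → ι → α → Option BitString
  encoding_mono : ∀ {t t' p y m}, t ≤ t' → encoding t p y = some m → encoding t' p y = some m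
  encoding_injective : ∀ {t p y y' m}, encoding t p y = some m → encoding t p y' = some m → y = y'

namespace EncodingSieve

variable {ι α : Type*} (S : EncodingSieve ι α) {t t' T m : ℕ} {p : ι} {y : α}

/-- A program is active at time `t` if it is seen by then to encode all targets. -/
def isActive (t : ℕ) (p : ι) : Bool := S.targets.all fun y => (S.encoding t p y).isSome

/-- The list of programs active at time `t`. -/
def active (t : ℕ) : List ι := S.programs.filter (S.isActive t)

/-- A target survives at time `t` if no active program gives it a code word that is too short. -/
def survives (t : ℕ) (y : α) : Bool :=
  (S.active t).all fun p => (S.encoding t p y).all fun m => decide (S.threshold p ≤ m.length)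

/-- The list of targets that survive at time `t`. -/
def survivors (t : ℕ) : List α := S.targets.filter (S.survives t)

/-- The total weight of the programs active at time `t`, thresholds being truncated at `m`. It
bounds the number of targets removed by the programs with thresholds at most `m`. -/
def weight (m t : ℕ) : ℕ := ((S.active t).map fun p => 2 ^ min (S.threshold p) m).sum

theorem weight_eq_sum [DecidableEq ι] :
    S.weight m t = ∑ p ∈ (S.active t).toFinset, 2 ^ min (S.threshold p) m :=
  (List.sum_toFinset _ (S.nodup_programs.filter _)).symm

variable {S}

theorem isActive_iff : S.isActive t p ↔ ∀ y ∈ S.targets, ∃ m, S.encoding t p y = some m := by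
  simp only [isActive, List.all_eq_true, Option.isSome_iff_exists]

theorem isActive_mono (h : t ≤ t') (hp : S.isActive t p) : S.isActive t' p :=
  isActive_iff.2 fun y hy => (isActive_iff.1 hp y hy).imp fun _ => S.encoding_mono h

theorem mem_active : p ∈ S.active t ↔ p ∈ S.programs ∧ S.isActive t p := List.mem_filter

theorem active_mono (h : t ≤ t') : S.active t ⊆ S.active t' := fun _ hp =>
  mem_active.2 ⟨(mem_active.1 hp).1, isActive_mono h (mem_active.1 hp).2⟩

theorem survives_iff :
    S.survives t y ↔
      ∀ p ∈ S.active t, ∀ m, S.encoding t p y = some m → S.threshold p ≤ m.length := by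
  simp only [survives, List.all_eq_true, Option.all_eq_true, decide_eq_true_eq]

theorem survives_anti (h : t ≤ t') (hy : S.survives t' y) : S.survives t y :=
  survives_iff.2 fun p hp m hm => survives_iff.1 hy p (active_mono h hp) m (S.encoding_mono h hm)

theorem exists_active_subset (S : EncodingSieve ι α) : ∃ T, ∀ t, S.active t ⊆ S.active T := by
  classical
  obtain ⟨T, hT⟩ := exists_forall_mem_finset_of_monotone (P := fun t p => S.isActive t p)
    (fun _ _ h _ => isActive_mono h) S.programs.toFinset
  refine ⟨T, fun t p hp => ?_⟩
  obtain ⟨hp, hact⟩ := mem_active.1 hp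
  exact mem_active.2 ⟨hp, hT p (List.mem_toFinset.2 hp) t hact⟩

theorem exists_isActive (hp : ∀ y ∈ S.targets, ∃ t m, S.encoding t p y = some m) :
    ∃ t, S.isActive t p := by
  classical
  obtain ⟨T, hT⟩ := exists_forall_mem_finset_of_monotone
    (P := fun t y => ∃ m, S.encoding t p y = some m)
    (fun _ _ h _ => Exists.imp fun _ => S.encoding_mono h) S.targets.toFinset
  refine ⟨T, isActive_iff.2 fun y hy => ?_⟩
  obtain ⟨t, ht⟩ := hp y hy
  exact hT y (List.mem_toFinset.2 hy) t ht

theorem threshold_le_of_survives (hT : ∀ t, S.active t ⊆ S.active T) (hy : S.survives T y)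
    (hyS : y ∈ S.targets) (hp : p ∈ S.programs) (hact : S.isActive t p) :
    ∃ m, S.encoding T p y = some m ∧ S.threshold p ≤ m.length := by
  have hpT : p ∈ S.active T := hT t (mem_active.2 ⟨hp, hact⟩)
  obtain ⟨m, hm⟩ := isActive_iff.1 (mem_active.1 hpT).2 y hyS
  exact ⟨m, hm, survives_iff.1 hy p hpT m hm⟩

theorem countP_removed_lt (h : t ≤ T) (hw : S.weight m t / 2 ^ m = S.weight m T / 2 ^ m) :
    S.targets.countP (fun y => S.survives t y && !S.survives T y) < 2 ^ m := by
  classical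
  rw [weight_eq_sum, weight_eq_sum] at hw
  refine lt_of_le_of_lt ?_ (sum_sdiff_two_pow_lt (fun p hp =>
    List.mem_toFinset.2 (active_mono h (List.mem_toFinset.1 hp))) hw)
  refine le_trans ?_ (card_filter_exists_short_le S.targets.toFinset _ S.threshold
    (f := S.encoding T) fun _ _ _ _ => S.encoding_injective)
  rw [List.countP_eq_length_filter, ← List.toFinset_card_of_nodup (S.nodup_targets.filter _)]
  refine Finset.card_le_card fun y hy => ?_
  simp only [List.mem_toFinset, List.mem_filter, Bool.and_eq_true, Bool.not_eq_true',
    ← Bool.not_eq_true, survives_iff] at hy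
  obtain ⟨hyS, hsurv, hremoved⟩ := hy
  push Not at hremoved
  obtain ⟨p, hp, m, hm, hshort⟩ := hremoved
  refine Finset.mem_filter.2 ⟨List.mem_toFinset.2 hyS, p, ?_, m, hm, hshort⟩
  refine Finset.mem_sdiff.2 ⟨List.mem_toFinset.2 hp, fun hpt => not_le.2 hshort ?_⟩
  rw [List.mem_toFinset] at hpt
  obtain ⟨m', hm'⟩ := isActive_iff.1 (mem_active.1 hpt).2 y hyS
  cases hm.symm.trans (S.encoding_mono h hm')
  exact hsurv p hpt m hm'

theorem mem_take_survivors (h : t ≤ T) (hw : S.weight m t / 2 ^ m = S.weight m T / 2 ^ m)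
    (hy : S.targets.find? (S.survives T) = some y) : y ∈ (S.survivors t).take (2 ^ m) :=
  mem_take_filter_of_find?_eq_some hy (survives_anti h (List.find?_some hy))
    (countP_removed_lt h hw)

theorem exists_find?_eq_some (hw : S.weight m T < 2 ^ m) (hm : 2 ^ m ≤ S.targets.length) :
    ∃ y, S.targets.find? (S.survives T) = some y := by
  classical
  refine Option.ne_none_iff_exists'.1 fun hnone => ?_
  have hsum : ∑ p ∈ (S.active T).toFinset, 2 ^ S.threshold p < 2 ^ m := by
    rw [← Finset.sdiff_empty (s := (S.active T).toFinset)]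
    refine sum_sdiff_two_pow_lt (Finset.empty_subset _) ?_
    rw [← weight_eq_sum, Nat.div_eq_of_lt hw, Finset.sum_empty, Nat.zero_div]
  have hcard := card_filter_exists_short_le S.targets.toFinset (S.active T).toFinset S.threshold
    (f := S.encoding T) fun _ _ _ _ => S.encoding_injective
  rw [Finset.filter_true_of_mem, List.toFinset_card_of_nodup S.nodup_targets] at hcard
  · omega
  · intro y hy
    have hremoved : ¬ S.survives T y := List.find?_eq_none.1 hnone y (List.mem_toFinset.1 hy)
    rw [survives_iff] at hremoved
    push Not at hremoved
    simpa only [List.mem_toFinset] using hremoved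

end EncodingSieve

end Sieve

section Complexity

theorem exists_program_of_condC_le {U : DescriptionMode} {A B : Type} [Primcodable A]
    [Primcodable B] {a : A} {b : B} {m : ℕ} (h : condC U a b ≤ m) :
    ∃ p : BitString, p.length ≤ m ∧ encode a ∈ U p (encode b) := by
  have hlt : condC U a b < ((m + 1 : ℕ) : ℕ∞) := h.trans_lt (by exact_mod_cast m.lt_succ_self)
  simp only [condC, iInf_lt_iff] at hlt
  obtain ⟨p, hp, hlen⟩ := hlt
  exact ⟨p, Nat.lt_succ_iff.1 (by exact_mod_cast hlen), hp⟩

theorem condC_le_of_mem {U : DescriptionMode} {A B : Type} [Primcodable A] [Primcodable B] {a : A}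
    {b : B} {p : BitString} (h : encode a ∈ U p (encode b)) : condC U a b ≤ p.length :=
  iInf₂_le p h

theorem IsOptimalMachine.exists_condC_le {U : DescriptionMode} (hU : IsOptimalMachine U) {σ : Type}
    [Primcodable σ] {f : BitString →. σ} (hf : Partrec f) :
    ∃ e : ℕ, ∀ p, ∀ a ∈ f p, ∀ {B : Type} [Primcodable B] (b : B),
      condC U a b ≤ ((p.length + e : ℕ) : ℕ∞) := by
  obtain ⟨e, he⟩ := hU.optimal (fun p _ => (f p).map encode)
    ((Partrec.map_encode_iff.2 hf).comp Computable.fst)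
  refine ⟨e, fun p a ha B _ b => ?_⟩
  obtain ⟨q, hq, hqa⟩ := he p (encode b) (encode a) (Part.mem_map _ ha)
  exact (condC_le_of_mem hqa).trans (by exact_mod_cast hq)

theorem exists_code_eval_encode {α σ : Type*} [Primcodable α] [Primcodable σ] {f : α →. σ}
    (hf : Partrec f) : ∃ c : Code, ∀ a, c.eval (encode a) = (f a).map encode := by
  obtain ⟨c, hc⟩ := Code.exists_code.1 hf
  exact ⟨c, fun a => by simp [hc]⟩

end Complexity

section ProtocolSieve

/-- The message that Bob sends on `y` in the protocol that the code `c`, given the condition `n`,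
computes from `p`, provided that within `t` steps the protocol is found and Alice restores `y` from
this message and the input `0…0` of length `n`. -/
def messageAt (c : Code) (n t : ℕ) (p y : BitString) : Option BitString :=
  (c.evaln t (encode (p, n))).bind fun e =>
    (decode₂ (Code × Code) e).bind fun P =>
      (P.2.evaln t (encode y)).bind fun r =>
        (decode₂ BitString r).bind fun m =>
          (P.1.evaln t (encode (List.replicate n false, m))).bind fun z =>
            bif z == encode y then some m else none

theorem messageAt_eq_some {c : Code} {n t : ℕ} {p y m : BitString} :
    messageAt c n t p y = some m ↔ ∃ P : Code × Code, encode P ∈ c.evaln t (encode (p, n)) ∧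
      encode m ∈ P.2.evaln t (encode y) ∧
      encode y ∈ P.1.evaln t (encode (List.replicate n false, m)) := by
  simp only [messageAt, Option.bind_eq_some_iff, decode₂_eq_some, Option.mem_def]
  constructor
  · rintro ⟨_, hP, P, rfl, _, hbob, m', rfl, z, halice, hz⟩
    cases hzy : z == encode y <;> simp only [hzy, cond_true, cond_false, reduceCtorEq] at hz
    cases hz
    exact ⟨P, hP, hbob, eq_of_beq hzy ▸ halice⟩
  · rintro ⟨P, hP, hbob, halice⟩
    exact ⟨_, hP, P, rfl, _, hbob, m, rfl, _, halice, by rw [beq_self_eq_true, cond_true]⟩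

theorem messageAt_mono {c : Code} {n t t' : ℕ} {p y m : BitString} (h : t ≤ t')
    (hm : messageAt c n t p y = some m) : messageAt c n t' p y = some m := by
  rw [messageAt_eq_some] at hm ⊢
  obtain ⟨P, hP, hbob, halice⟩ := hm
  exact ⟨P, Code.evaln_mono h hP, Code.evaln_mono h hbob, Code.evaln_mono h halice⟩

theorem messageAt_injective {c : Code} {n t : ℕ} {p y y' m : BitString}
    (hm : messageAt c n t p y = some m) (hm' : messageAt c n t p y' = some m) : y = y' := by
  rw [messageAt_eq_some] at hm hm'
  obtain ⟨P, hP, -, halice⟩ := hm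
  obtain ⟨P', hP', -, halice'⟩ := hm'
  obtain rfl : P = P' := encode_injective (Option.mem_unique hP hP')
  exact encode_injective (Option.mem_unique halice halice')

theorem exists_messageAt_eq_some {c : Code} {n : ℕ} {p y m : BitString} {P : OneWayProtocol}
    (hP : encode (P.alice, P.bob) ∈ c.eval (encode (p, n))) (hm : P.Sends y m)
    (hy : P.Outputs (List.replicate n false) m y) : ∃ t, messageAt c n t p y = some m := by
  obtain ⟨t₁, h₁⟩ := Code.evaln_complete.1 hP
  obtain ⟨t₂, h₂⟩ := Code.evaln_complete.1 hm
  obtain ⟨t₃, h₃⟩ := Code.evaln_complete.1 hy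
  refine ⟨max t₁ (max t₂ t₃), messageAt_eq_some.2 ⟨(P.alice, P.bob), ?_, ?_, ?_⟩⟩
  · exact Code.evaln_mono (by simp) h₁
  · exact Code.evaln_mono (by simp) h₂
  · exact Code.evaln_mono (by simp) h₃

theorem sends_of_messageAt_eq_some {c : Code} {n t : ℕ} {p y m : BitString} {P : OneWayProtocol}
    (hP : encode (P.alice, P.bob) ∈ c.eval (encode (p, n)))
    (hm : messageAt c n t p y = some m) : P.Sends y m := by
  obtain ⟨Q, hQ, hbob, -⟩ := messageAt_eq_some.1 hm
  obtain rfl : Q = (P.alice, P.bob) :=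
    encode_injective (Part.mem_unique (Code.evaln_sound hQ) hP)
  exact Code.evaln_sound hbob

@[fun_prop]
theorem primrec_messageAt {σ : Type*} [Primcodable σ] {c : Code} {n t : σ → ℕ}
    {p y : σ → BitString} (hn : Primrec n) (ht : Primrec t) (hp : Primrec p) (hy : Primrec y) :
    Primrec fun a => messageAt c (n a) (t a) (p a) (y a) := by
  unfold messageAt
  fun_prop

/-- The sieve that keeps the strings of length `h 0` on which every total protocol described by a
program of length `j` sends at least `h (j + logLen k)` bits, as long as `j + logLen k ≤ k`.
The shift by `logLen k` compensates for the number of possible lengths `j`. -/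
def profileSieve (c : Code) (h : ℕ → ℕ) (k : ℕ) : EncodingSieve BitString BitString where
  targets := bitStrings (h 0)
  nodup_targets := nodup_bitStrings _
  programs := bitStringsBelow (k + 1 - logLen k)
  nodup_programs := nodup_bitStringsBelow _
  threshold p := h (p.length + logLen k)
  encoding := messageAt c (h 0)
  encoding_mono := messageAt_mono
  encoding_injective := messageAt_injective

theorem lt_two_pow_logLen (n : ℕ) : n < 2 ^ logLen n := Nat.lt_pow_succ_log_self one_lt_two n

theorem one_le_logLen (n : ℕ) : 1 ≤ logLen n := Nat.succ_pos _

theorem weight_profileSieve_lt {c : Code} {h : ℕ → ℕ} {k i : ℕ} (t : ℕ)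
    (hh : AntitoneOn (fun i => h i + i) (Set.Iic k)) (hi : i ≤ k) :
    (profileSieve c h k).weight (h i) t < 2 ^ i * 2 ^ h i := by
  have hle : (profileSieve c h k).weight (h i) t ≤
      ∑ j ∈ Finset.range (k + 1 - logLen k), 2 ^ j * 2 ^ min (h (j + logLen k)) (h i) := by
    rw [← sum_map_length_bitStringsBelow]
    exact (List.filter_sublist.map _).sum_le_sum fun _ _ => Nat.zero_le _
  have hterm : ∀ j ∈ Finset.range (k + 1 - logLen k),
      2 ^ j * 2 ^ min (h (j + logLen k)) (h i) * 2 ^ logLen k ≤ 2 ^ i * 2 ^ h i := by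
    intro j hj
    rw [← pow_add, ← pow_add, ← pow_add]
    refine Nat.pow_le_pow_right two_pos ?_
    rw [Finset.mem_range] at hj
    rcases le_total i (j + logLen k) with hij | hij
    · have : h (j + logLen k) + (j + logLen k) ≤ h i + i :=
        hh (Set.mem_Iic.2 hi) (Set.mem_Iic.2 (by omega)) hij
      omega
    · omega
  refine Nat.lt_of_mul_lt_mul_right (a := 2 ^ logLen k) ?_
  calc (profileSieve c h k).weight (h i) t * 2 ^ logLen k
      ≤ (k + 1 - logLen k) * (2 ^ i * 2 ^ h i) := by
        refine (Nat.mul_le_mul_right _ hle).trans ?_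
        rw [Finset.sum_mul]
        simpa using Finset.sum_le_card_nsmul _ _ _ hterm
    _ < 2 ^ i * 2 ^ h i * 2 ^ logLen k := by
        rw [mul_comm]
        refine Nat.mul_lt_mul_of_pos_left ?_ (by positivity)
        have := lt_two_pow_logLen k
        have := one_le_logLen k
        omega

theorem exists_isActive_profileSieve {c : Code} {h : ℕ → ℕ} {k : ℕ} {p : BitString}
    {P : OneWayProtocol} (hP : encode (P.alice, P.bob) ∈ c.eval (encode (p, h 0)))
    (htot : P.TotallyComputes (h 0) identityFn) : ∃ t, (profileSieve c h k).isActive t p := by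
  refine EncodingSieve.exists_isActive fun y hy => ?_
  obtain ⟨m, hm, hout⟩ := htot _ y List.length_replicate (mem_bitStrings.1 hy)
  obtain ⟨t, ht⟩ := exists_messageAt_eq_some hP hm hout
  exact ⟨t, m, ht⟩

theorem le_TCC_of_survives_profileSieve {U : DescriptionMode} {c : Code}
    (hc : ∀ p z, c.eval (encode (p, z)) = U p z) {h : ℕ → ℕ} {k T α : ℕ} {y : BitString}
    (hh : AntitoneOn (fun i => h i + i) (Set.Iic k))
    (hT : ∀ t, (profileSieve c h k).active t ⊆ (profileSieve c h k).active T)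
    (hyn : y.length = h 0) (hy : (profileSieve c h k).survives T y) (hα : α + logLen k ≤ k) :
    (h (α + logLen k) : ℕ∞) ≤ TCC U identityFn α y := by
  refine le_iInf fun P => le_iInf fun m => le_iInf fun htot => le_iInf fun hcomp =>
    le_iInf fun hm => ?_
  rw [hyn] at htot hcomp
  obtain ⟨p, hpα, hp⟩ := exists_program_of_condC_le hcomp
  rw [encode_nat, ← hc] at hp
  obtain ⟨t, hact⟩ := exists_isActive_profileSieve hp htot
  obtain ⟨m', hm', hlong⟩ := EncodingSieve.threshold_le_of_survives hT hy (mem_bitStrings.2 hyn)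
    (mem_bitStringsBelow.2 (by omega)) hact
  obtain rfl : m' = m :=
    encode_injective (Part.mem_unique (sends_of_messageAt_eq_some hp hm') hm)
  have hanti : h (α + logLen k) + (α + logLen k) ≤
      h (p.length + logLen k) + (p.length + logLen k) :=
    hh (Set.mem_Iic.2 (by omega)) (Set.mem_Iic.2 hα) (by omega)
  change h (p.length + logLen k) ≤ m'.length at hlong
  exact_mod_cast (by omega : h (α + logLen k) ≤ m'.length)

end ProtocolSieve

section Listing

/-- The list of the first `2 ^ h i` strings that survive in the profile sieve, at the first time
when the weight at truncation `h i` reaches the `rank q`-th multiple of `2 ^ h i`, where `i` is the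
length of `q`. The list comes with the number `h i`. -/
def levelListing (c : Code) (h : ℕ → ℕ) (k : ℕ) (q : BitString) : Part (ℕ × List BitString) :=
  (Nat.rfind fun t => Part.some
    ((profileSieve c h k).weight (h q.length) t / 2 ^ h q.length == rank q)).map fun t =>
      (h q.length, ((profileSieve c h k).survivors t).take (2 ^ h q.length))

theorem exists_mem_levelListing {c : Code} {h : ℕ → ℕ} {k i T : ℕ} {y : BitString}
    (hh : AntitoneOn (fun i => h i + i) (Set.Iic k)) (hi : i ≤ k)
    (hy : (profileSieve c h k).targets.find? ((profileSieve c h k).survives T) = some y) :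
    ∃ q A, q.length = i ∧ (h i, A) ∈ levelListing c h k q ∧ A.length ≤ 2 ^ h i ∧ y ∈ A := by
  set S := profileSieve c h k
  obtain ⟨q, rfl, hq⟩ := exists_length_eq_rank_eq
    ((Nat.div_lt_iff_lt_mul (by positivity)).2 (weight_profileSieve_lt (c := c) T hh hi))
  obtain ⟨t, ht, htT⟩ := Nat.rfind_min'
    (p := fun t => S.weight (h q.length) t / 2 ^ h q.length == rank q) (m := T)
    (by simp [S, hq])
  have hw : S.weight (h q.length) t / 2 ^ h q.length = S.weight (h q.length) T / 2 ^ h q.length :=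
    (eq_of_beq (Part.mem_some_iff.1 (Nat.rfind_spec ht)).symm).trans hq
  exact ⟨q, _, rfl, Part.mem_map _ ht, List.length_take_le _ _,
    EncodingSieve.mem_take_survivors htT hw hy⟩

theorem partrec_levelListing {σ : Type*} [Primcodable σ] (c : Code) {table : σ → List ℕ}
    {q : σ → BitString} (htable : Primrec table) (hq : Primrec q) : Partrec fun a =>
      levelListing c ((table a).getD · 0) ((table a).length - 1) (q a) := by
  have hweight : Primrec fun a : σ × ℕ =>
      (profileSieve c ((table a.1).getD · 0) ((table a.1).length - 1)).weight
        ((table a.1).getD (q a.1).length 0) a.2 / 2 ^ (table a.1).getD (q a.1).length 0 ==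
          rank (q a.1) := by
    unfold profileSieve EncodingSieve.weight EncodingSieve.active EncodingSieve.isActive
    dsimp only
    fun_prop
  have hlist : Primrec fun a : σ × ℕ => ((table a.1).getD (q a.1).length 0,
      ((profileSieve c ((table a.1).getD · 0) ((table a.1).length - 1)).survivors a.2).take
        (2 ^ (table a.1).getD (q a.1).length 0)) := by
    unfold profileSieve EncodingSieve.survivors EncodingSieve.survives EncodingSieve.active
      EncodingSieve.isActive
    dsimp only
    fun_prop
  exact (Partrec.rfind hweight.to_comp.to₂.partrec₂).map hlist.to_comp.to₂

theorem length_valueTable (h : ℕ → ℕ) (k : ℕ) : (valueTable h k).length = k + 1 := by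
  simp [valueTable]

theorem getD_valueTable {h : ℕ → ℕ} {k i : ℕ} (hi : i ≤ k) : (valueTable h k).getD i 0 = h i := by
  simp [valueTable, Nat.lt_succ_of_le hi]

/-- Interprets a program as a self-delimited `U`-description of the table of a profile `h`, followed
by a string `q` from which the list `levelListing` is computed. -/
def profileListing (U : DescriptionMode) (c : Code) (p : BitString) : Part (ℕ × List BitString) :=
  (U (splitSelfDelimited p).1 0).bind fun e =>
    (decode₂ (List ℕ) e : Part (List ℕ)).bind fun table =>
      levelListing c (table.getD · 0) (table.length - 1) (splitSelfDelimited p).2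

theorem partrec_profileListing {U : DescriptionMode} (hU : Partrec₂ U) (c : Code) :
    Partrec (profileListing U c) := by
  have hfst : Primrec fun p => (splitSelfDelimited p).1 :=
    Primrec.fst.comp primrec_splitSelfDelimited
  have hsnd : Primrec fun a : (BitString × ℕ) × List ℕ => (splitSelfDelimited a.1.1).2 :=
    Primrec.snd.comp (primrec_splitSelfDelimited.comp (Primrec.fst.comp Primrec.fst))
  have hdecode : Partrec fun a : BitString × ℕ => (decode₂ (List ℕ) a.2 : Part (List ℕ)) :=
    (Primrec.decode₂.comp Primrec.snd).to_comp.ofOption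
  have hlevel : Partrec₂ fun (a : BitString × ℕ) (table : List ℕ) =>
      levelListing c (table.getD · 0) (table.length - 1) (splitSelfDelimited a.1).2 :=
    partrec_levelListing c Primrec.snd hsnd
  exact (hU.comp hfst.to_comp (Computable.const 0)).bind (hdecode.bind hlevel).to₂

theorem mem_profileListing {U : DescriptionMode} {c : Code} {h : ℕ → ℕ} {k : ℕ} {r q : BitString}
    {a : ℕ × List BitString} (hr : encode (valueTable h k) ∈ U r 0)
    (ha : a ∈ levelListing c ((valueTable h k).getD · 0) k q) :
    a ∈ profileListing U c (selfDelimit r ++ q) := by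
  simp only [profileListing, splitSelfDelimited_selfDelimit_append, Part.mem_bind_iff]
  refine ⟨_, hr, valueTable h k, by simp, ?_⟩
  rwa [length_valueTable, Nat.add_sub_cancel]

theorem exists_string_of_profile {U : DescriptionMode} (hU : Partrec₂ U) :
    ∃ f : BitString →. ℕ × List BitString, Partrec f ∧ ∀ (k : ℕ) (h : ℕ → ℕ) (s : ℕ),
      AntitoneOn (fun i => h i + i) (Set.Iic k) → plainC U (valueTable h k) ≤ s →
      ∃ y : BitString, y.length = h 0 ∧
        (∀ α, α + logLen k ≤ k → (h (α + logLen k) : ℕ∞) ≤ TCC U identityFn α y) ∧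
        ∀ i ≤ k, ∃ p A, p.length ≤ i + (2 * s + 1) ∧ (h i, A) ∈ f p ∧
          A.length ≤ 2 ^ h i ∧ y ∈ A := by
  obtain ⟨c, hc⟩ := exists_code_eval_encode hU
  replace hc (p : BitString) (z : ℕ) : c.eval (encode (p, z)) = U p z := by
    rw [hc]; exact Part.map_id' (fun _ => rfl) _
  refine ⟨profileListing U c, partrec_profileListing hU c, fun k h s hh hs => ?_⟩
  obtain ⟨r, hrs, hr⟩ := exists_program_of_condC_le hs
  set g : ℕ → ℕ := ((valueTable h k).getD · 0)
  have hgh {i : ℕ} (hi : i ≤ k) : g i = h i := getD_valueTable hi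
  replace hh : AntitoneOn (fun i => g i + i) (Set.Iic k) :=
    hh.congr fun i hi => by simp only [hgh hi]
  obtain ⟨T, hT⟩ := EncodingSieve.exists_active_subset (profileSieve c g k)
  obtain ⟨y, hy⟩ := EncodingSieve.exists_find?_eq_some (S := profileSieve c g k) (m := g 0) (T := T)
    (by simpa using weight_profileSieve_lt (c := c) T hh k.zero_le) (length_bitStrings _).ge
  have hyn : y.length = g 0 := mem_bitStrings.1 (List.mem_of_find?_eq_some hy)
  refine ⟨y, hyn.trans (hgh k.zero_le), fun α hα => ?_, fun i hi => ?_⟩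
  · rw [← hgh hα]
    exact le_TCC_of_survives_profileSieve hc hh hT hyn (List.find?_some hy) hα
  · obtain ⟨q, A, rfl, hA, hlen, hyA⟩ := exists_mem_levelListing hh hi hy
    rw [← hgh hi]
    refine ⟨selfDelimit r ++ q, A, ?_, mem_profileListing hr hA, hlen, hyA⟩
    rw [List.length_append, length_selfDelimit]
    omega

end Listing

section Communication

variable {α : Type*} [DecidableEq α] {A B : List α} {x : α}

/-- Replaces `x` by the entry of `B` at the place where `x` stands in `A`, if there is one. -/
def recode (A B : List α) (x : α) : α := (B[A.idxOf x]?).getD x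

theorem recode_of_notMem (hl : A.length = B.length) (hx : x ∉ A) : recode A B x = x := by
  rw [recode, List.idxOf_eq_length hx, hl, List.getElem?_length, Option.getD_none]

theorem recode_of_mem (hl : A.length = B.length) (hx : x ∈ A) :
    ∃ h : A.idxOf x < B.length, recode A B x = B[A.idxOf x] := by
  have h : A.idxOf x < B.length := hl ▸ List.idxOf_lt_length_of_mem hx
  exact ⟨h, by simp [recode, h]⟩

theorem recode_recode (hl : A.length = B.length) (hB : B.Nodup) (hx : x ∈ B → x ∈ A) :
    recode B A (recode A B x) = x := by
  by_cases hxA : x ∈ A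
  · obtain ⟨h, hrec⟩ := recode_of_mem hl hxA
    obtain ⟨hidx, hrec'⟩ := recode_of_mem hl.symm (List.getElem_mem h)
    rw [hrec, hrec']
    simp only [hB.idxOf_getElem, List.getElem_idxOf]
  · rw [recode_of_notMem hl hxA, recode_of_notMem hl.symm fun h => hxA (hx h)]

@[fun_prop]
theorem primrec_recode {σ α : Type*} [Primcodable σ] [Primcodable α] [DecidableEq α]
    {A B : σ → List α} {x : σ → α} (hA : Primrec A) (hB : Primrec B) (hx : Primrec x) :
    Primrec fun a => recode (A a) (B a) (x a) := by
  unfold recode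
  fun_prop

theorem exists_recodeProtocol :
    ∃ F : List BitString × List BitString → Code × Code, Primrec F ∧ ∀ A B x y,
      let P : OneWayProtocol := ⟨(F (A, B)).1, (F (A, B)).2⟩
      P.Sends y (recode A B y) ∧ P.Outputs x y (recode B A y) := by
  obtain ⟨bob, hbob⟩ := exists_code_eval_encode
    (f := fun a : (List BitString × List BitString) × BitString =>
      Part.some (recode a.1.1 a.1.2 a.2)) (Computable.partrec (Primrec.to_comp (by fun_prop)))
  obtain ⟨alice, halice⟩ := exists_code_eval_encode
    (f := fun a : (List BitString × List BitString) × BitString × BitString =>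
      Part.some (recode a.1.2 a.1.1 a.2.2)) (Computable.partrec (Primrec.to_comp (by fun_prop)))
  refine ⟨fun a => (alice.curry (encode a), bob.curry (encode a)), by fun_prop,
    fun A B x y => ⟨?_, ?_⟩⟩
  · rw [OneWayProtocol.Sends, Code.eval_curry, ← encode_prod_val, hbob]
    exact Part.mem_map _ (Part.mem_some _)
  · rw [OneWayProtocol.Outputs, Code.eval_curry, ← encode_prod_val, halice]
    exact Part.mem_map _ (Part.mem_some _)

theorem TCC_le {U : DescriptionMode} {f : BitString → BitString → BitString} {α : ℕ}
    {y m : BitString} {P : OneWayProtocol} (htot : P.TotallyComputes y.length f)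
    (hα : P.complexity U y.length ≤ α) (hm : P.Sends y m) : TCC U f α y ≤ m.length :=
  iInf_le_of_le P <| iInf_le_of_le m <| iInf_le_of_le htot <| iInf_le_of_le hα <| iInf_le _ hm

theorem TCC_anti {U : DescriptionMode} {f : BitString → BitString → BitString} {α β : ℕ}
    {y : BitString} (h : α ≤ β) : TCC U f β y ≤ TCC U f α y :=
  le_iInf fun _ => le_iInf fun _ => le_iInf fun htot => le_iInf fun hα => le_iInf fun hm =>
    TCC_le htot (hα.trans (by exact_mod_cast h)) hm

namespace IsOptimalMachine

variable {U : DescriptionMode}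

theorem exists_TCC_le_length_recode (hU : IsOptimalMachine U)
    {f : BitString →. List BitString × List BitString} (hf : Partrec f) :
    ∃ e : ℕ, ∀ p A B y, (A, B) ∈ f p → A.length = B.length → B.Nodup →
      (∀ z ∈ B, z.length ≠ y.length) →
      TCC U identityFn (p.length + e) y ≤ (recode A B y).length := by
  obtain ⟨F, hF, hrec⟩ := exists_recodeProtocol
  obtain ⟨e, he⟩ := hU.exists_condC_le (hf.map (hF.comp Primrec.snd).to_comp.to₂)
  refine ⟨e, fun p A B y hAB hl hB hBy => ?_⟩
  refine TCC_le (P := ⟨(F (A, B)).1, (F (A, B)).2⟩) (fun x z _ hz => ⟨_, (hrec A B x z).1, ?_⟩)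
    (he p _ (Part.mem_map _ hAB) y.length) (hrec A B y y).1
  have hout := (hrec A B x (recode A B z)).2
  rwa [recode_recode hl hB fun hzB => absurd hz (hBy z hzB)] at hout

theorem exists_TCC_le_length (hU : IsOptimalMachine U) :
    ∃ e : ℕ, ∀ y, TCC U identityFn e y ≤ y.length := by
  obtain ⟨e, he⟩ := hU.exists_TCC_le_length_recode (f := fun _ => Part.some ([], []))
    (Computable.partrec (Computable.const ([], [])))
  refine ⟨e, fun y => ?_⟩
  simpa [recode] using he [] [] [] y (Part.mem_some _) rfl List.nodup_nil (by simp)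

theorem exists_TCC_le_of_mem_list (hU : IsOptimalMachine U)
    {f : BitString →. ℕ × List BitString} (hf : Partrec f) :
    ∃ e : ℕ, ∀ p m A, (m, A) ∈ f p → A.length ≤ 2 ^ m → ∀ y ∈ A,
      TCC U identityFn (p.length + e) y ≤ m := by
  have hpair : Primrec fun a : ℕ × List BitString => (a.2, (bitStrings a.1).take a.2.length) := by
    fun_prop
  obtain ⟨e, he⟩ := hU.exists_TCC_le_length
  obtain ⟨e', he'⟩ := hU.exists_TCC_le_length_recode (hf.map (hpair.comp Primrec.snd).to_comp.to₂)
  refine ⟨e + e', fun p m A hA hlen y hy => ?_⟩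
  rcases le_or_gt y.length m with hym | hmy
  · exact (TCC_anti (by omega)).trans ((he y).trans (by exact_mod_cast hym))
  have hl : A.length = ((bitStrings m).take A.length).length := by
    rw [List.length_take, length_bitStrings, min_eq_left hlen]
  have hB : ∀ z ∈ (bitStrings m).take A.length, z.length = m := fun z hz =>
    mem_bitStrings.1 (List.mem_of_mem_take hz)
  obtain ⟨hidx, hrec⟩ := recode_of_mem hl hy
  calc TCC U identityFn (p.length + (e + e')) y
      ≤ TCC U identityFn (p.length + e') y := TCC_anti (by omega)
    _ ≤ (recode A ((bitStrings m).take A.length) y).length :=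
        he' p _ _ y (Part.mem_map _ hA) hl ((nodup_bitStrings m).sublist (List.take_sublist _ _))
          fun z hz => by rw [hB z hz]; exact hmy.ne
    _ = m := by rw [hrec, hB _ (List.getElem_mem hidx)]

theorem exists_plainC_le_of_mem_list (hU : IsOptimalMachine U)
    {f : BitString →. ℕ × List BitString} (hf : Partrec f) :
    ∃ e : ℕ, ∀ p m A, (m, A) ∈ f p → A.length ≤ 1 → ∀ y ∈ A,
      plainC U y ≤ ((p.length + e : ℕ) : ℕ∞) := by
  have hhead : Primrec fun a : ℕ × List BitString => a.2.headI := by fun_prop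
  obtain ⟨e, he⟩ := hU.exists_condC_le (hf.map (hhead.comp Primrec.snd).to_comp.to₂)
  refine ⟨e, fun p m A hA hlen y hy => he p y ?_ ()⟩
  obtain rfl : A = [y] := by
    obtain ⟨z, rfl⟩ := List.length_eq_one_iff.1 (hlen.antisymm (List.length_pos_of_mem hy))
    rw [List.mem_singleton.1 hy]
  exact Part.mem_map (fun a : ℕ × List BitString => a.2.headI) hA

theorem exists_TCC_le_zero (hU : IsOptimalMachine U) :
    ∃ e : ℕ, ∀ (y : BitString) (m : ℕ), plainC U y ≤ m → TCC U identityFn (m + e) y ≤ 0 := by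
  have hdecode : Partrec fun q => (U q 0).bind fun a =>
      (decode₂ BitString a : Part BitString).map fun y => (0, [y]) := by
    refine (hU.partrec.comp Computable.id (Computable.const 0)).bind ?_
    refine (Primrec.decode₂.comp Primrec.snd).to_comp.ofOption.map (Primrec.to_comp ?_)
    fun_prop
  obtain ⟨e, he⟩ := hU.exists_TCC_le_of_mem_list hdecode
  refine ⟨e, fun y m hm => ?_⟩
  obtain ⟨q, hq, hqy⟩ := exists_program_of_condC_le hm
  refine (TCC_anti (by omega)).trans (he q 0 [y] ?_ (by simp) y (by simp))
  simp only [Part.mem_bind_iff, Part.mem_map_iff]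
  exact ⟨_, hqy, y, by simp, rfl⟩

theorem exists_le_plainC (hU : IsOptimalMachine U) : ∃ e : ℕ, ∀ (y : BitString) (k δ : ℕ),
    (∀ α, α + δ < k → 0 < TCC U identityFn α y) → (k : ℕ∞) ≤ plainC U y + ((δ + e : ℕ) : ℕ∞) := by
  obtain ⟨e, he⟩ := hU.exists_TCC_le_zero
  refine ⟨e, fun y k δ hpos => ?_⟩
  by_contra! hlt
  obtain ⟨m, hm⟩ := ENat.ne_top_iff_exists.1 (fun htop => by simp [htop] at hlt :
    plainC U y ≠ ⊤)
  rw [← hm] at hlt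
  have hlt : m + (δ + e) < k := by exact_mod_cast hlt
  exact (hpos (m + e) (by omega)).not_ge (he y m hm.ge)

end IsOptimalMachine

end Communication

theorem logLen_mono : Monotone logLen := fun _ _ h => Nat.succ_le_succ (Nat.log_mono_right h)

theorem antitoneOn_add_id_of_strictAntiOn {h : ℕ → ℕ} {k : ℕ}
    (hh : StrictAntiOn h (Set.Icc 0 k)) : AntitoneOn (fun i => h i + i) (Set.Iic k) := by
  refine antitoneOn_of_succ_le Set.ordConnected_Iic fun i _ hi hi' => ?_
  have hlt : h (i + 1) < h i := hh ⟨i.zero_le, hi⟩ ⟨(i + 1).zero_le, hi'⟩ i.lt_succ_self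
  change h (i + 1) + (i + 1) ≤ h i + i
  omega

theorem mainTheorem2 (U : DescriptionMode) (hU : IsOptimalMachine U) (c : ℕ) :
    ∃ d : ℕ, ∀ (n k : ℕ) (h : ℕ → ℕ), k ≤ n →
      StrictAntiOn h (Set.Icc 0 k) → h 0 = n → h k = 0 →
      plainC U (valueTable h k) ≤ ((c * logLen n : ℕ) : ℕ∞) →
      (∀ α ≤ k, k ≤ h α + α) →
      ∃ y : BitString, y.length = n ∧
        plainC U y ≤ ((k + d * logLen n : ℕ) : ℕ∞) ∧
        (k : ℕ∞) ≤ plainC U y + ((d * logLen n : ℕ) : ℕ∞) ∧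
        (∀ α ≤ k, TCC U identityFn (α + d * logLen n) y ≤ (h α : ℕ∞)) ∧
        (∀ α : ℕ, α + d * logLen n ≤ k →
          (h (α + d * logLen n) : ℕ∞) ≤ TCC U identityFn α y) := by
  obtain ⟨f, hf, hstring⟩ := exists_string_of_profile hU.partrec
  obtain ⟨a, ha⟩ := hU.exists_plainC_le_of_mem_list hf
  obtain ⟨b, hb⟩ := hU.exists_le_plainC
  obtain ⟨e, he⟩ := hU.exists_TCC_le_of_mem_list hf
  refine ⟨2 * c + 2 + a + b + e, fun n k h hkn hanti h0 hk hC _ => ?_⟩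
  obtain ⟨y, hyn, hlow, hlist⟩ :=
    hstring k h (c * logLen n) (antitoneOn_add_id_of_strictAntiOn hanti) hC
  set d := 2 * c + 2 + a + b + e
  have hd : logLen k + 2 * (c * logLen n) + 1 + a + b + e ≤ d * logLen n := by
    calc logLen k + 2 * (c * logLen n) + 1 + a + b + e
        ≤ logLen n + 2 * (c * logLen n) + (1 + a + b + e) * logLen n := by
          linarith [logLen_mono hkn, Nat.le_mul_of_pos_right (1 + a + b + e) (one_le_logLen n)]
      _ = d * logLen n := by ring
  refine ⟨y, hyn.trans h0, ?_, ?_, fun α hα => ?_, fun α hα => ?_⟩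
  · obtain ⟨p, A, hp, hA, hlen, hy⟩ := hlist k le_rfl
    exact (ha p _ A hA (by simpa [hk] using hlen) y hy).trans (by exact_mod_cast (by omega))
  · refine (hb y k (logLen k) fun α hα => (hlow α hα.le).trans_lt' ?_).trans
      (by gcongr; exact_mod_cast (by omega))
    exact_mod_cast hk ▸ hanti ⟨Nat.zero_le _, hα.le⟩ ⟨k.zero_le, le_rfl⟩ hα
  · obtain ⟨p, A, hp, hA, hlen, hy⟩ := hlist α hα
    exact (TCC_anti (by omega)).trans (he p _ A hA hlen y hy)
  · refine (hlow α (by omega)).trans' ?_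
    exact_mod_cast hanti.antitoneOn ⟨Nat.zero_le _, by omega⟩ ⟨Nat.zero_le _, hα⟩ (by omega)
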